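/- A finite connected weighted graph $G$ consists of a finite vertex set $V(G)$ with at least two elements and a symmetric weight function $\mu^G:V(G)^2\to[0,\infty)$ such that the graph whose edges are the pairs $\{x,y\}$ with $\mu^G_{xy}>0$ is connected (loops, $\mu^G_{xx}>0$, are permitted). Write $\mu^G_x=\sum_y\mu^G_{xy}$, $\mu^G(A)=\sum_{x\in A}\mu^G_x$ and $m(G)=\mu^G(V(G))$. Under $\mathbf P^G_z$, let $(X^G_t)_{t=0,1,2,\dots}$ be the Markov chain on $V(G)$ started at $z$ with transition probabilities $\mu^G_{xy}/\mu^G_x$, and let $$L^G_t(x)=\frac1{\mu^G_x}\sum_{i=0}^{t-1}\mathbf 1_{\{X^G_i=x\}}$$ be its local times (with $L^G_0=0$). With $\mathcal E_G(f,f)=\frac12\sum_{x,y}(f(x)-f(y))^2\mu^G_{xy}$, the resistance metric is given by $R_G(x,x)=0$ and $$R_G(x,y)^{-1}=\inf\{\mathcal E_G(f,f): f:V(G)\to\mathbb R,\ f(x)=0,\ f(y)=1\}\qquad(x\ne y).$$ Let $B_G(x,r)=\{y:R_G(x,y)<r\}$, $r(G)=\max_{x,y}R_G(x,y)$, $r_0(G)=\min_{x\neq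 y}R_G(x,y)$ and $\tilde R_G(x,y)=r(G)^{-1}R_G(x,y)$. A collection $(G_i)_{i\in I}$ of such graphs satisfies uniform volume growth with volume doubling (UVD) if there are constants $c_1,c_2,c_3\in(0,\infty)$ and a non-decreasing function $v:[0,\infty)\to[0,\infty)$ with $v(2r)\le c_3v(r)$ for all $r\ge0$ such that $c_1v(r)\le\mu^{G_i}(B_{G_i}(x,r))$ for all $i\in I$, $x\in V(G_i)$, $r\in[r_0(G_i),r(G_i)]$, and $m(G_i)\le c_2v(r(G_i))$ for all $i\in I$. Theorem. If $(G_i)_{i\in I}$ satisfies UVD, then, for each $T>0$, $$\lim_{\lambda\to\infty}\sup_{i\in I}\max_{z\in V(G_i)}\mathbf P^{G_i}_z\left(\max_{x,y\in V(G_i)}\ \max_{0\le t\le Tm(G_i)r(G_i)}\frac{r(G_i)^{-1}\left|L^{G_i}_t(x)-L^{G_i}_t(y)\right|}{\sqrt{\tilde R_{G_i}(x,y)\left(1+\ln\tilde R_{G_i}(x,y)^{-1}\right)}}\ge\lambda\right)=0,$$ where $t$ ranges over integers and the ratio is taken to be $0$ when $x=y$. -/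

import Mathlib

open MeasureTheory ProbabilityTheory Filter Topology

noncomputable section

/-- A connected weighted graph with vertex set `V`, given by its symmetric non-negative weights.
The edges are the pairs `{x, y}` with `0 < weight x y`; a positive diagonal weight is a loop. -/
structure WeightedGraph (V : Type*) where
  weight : V → V → ℝ
  weight_nonneg : ∀ x y, 0 ≤ weight x y
  weight_symm : ∀ x y, weight x y = weight y x
  connected : ∀ x y, Relation.ReflTransGen (fun a b => 0 < weight a b) x y

namespace WeightedGraph

variable {V : Type*} [Fintype V]

/-- `μ_x = ∑_y μ_{xy}`. -/
def vertexWeight (G : WeightedGraph V) (x : V) : ℝ := ∑ y, G.weight x y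

/-- The measure `μ(A) = ∑_{x ∈ A} μ_x`. -/
def vol (G : WeightedGraph V) (A : Set V) : ℝ := ∑ x, A.indicator G.vertexWeight x

/-- The total mass `m(G)`. -/
def totalMass (G : WeightedGraph V) : ℝ := G.vol Set.univ

/-- The Dirichlet form `𝓔(f, g) = ½ ∑_{x,y} (f x - f y) (g x - g y) μ_{xy}`
(pairs which are not edges have weight zero). -/
def dirichletForm (G : WeightedGraph V) (f g : V → ℝ) : ℝ :=
  (1 / 2) * ∑ x, ∑ y, (f x - f y) * (g x - g y) * G.weight x y

/-- The effective resistance between `A` and `B` (meant for disjoint non-empty sets), defined by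
`R(A, B)⁻¹ = inf {𝓔(f, f) : f = 0 on A, f = 1 on B}`. -/
def effectiveResistance (G : WeightedGraph V) (A B : Set V) : ℝ :=
  (sInf {e : ℝ | ∃ f : V → ℝ, (∀ a ∈ A, f a = 0) ∧ (∀ b ∈ B, f b = 1) ∧
    e = G.dirichletForm f f})⁻¹

open Classical in
/-- The resistance metric. -/
def resistance (G : WeightedGraph V) (x y : V) : ℝ :=
  if x = y then 0 else G.effectiveResistance {x} {y}

/-- The diameter `r(G)` in the resistance metric. -/
def resistanceDiam (G : WeightedGraph V) : ℝ := ⨆ x : V, ⨆ y : V, G.resistance x y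

/-- The minimal resistance `r₀(G)` between two distinct vertices. -/
def minResistance (G : WeightedGraph V) : ℝ :=
  ⨅ p : {p : V × V // p.1 ≠ p.2}, G.resistance p.1.1 p.1.2

/-- The resistance metric divided by the diameter. -/
def scaledResistance (G : WeightedGraph V) (x y : V) : ℝ :=
  G.resistanceDiam⁻¹ * G.resistance x y

/-- The open ball in the resistance metric. -/
def resistanceBall (G : WeightedGraph V) (x : V) (r : ℝ) : Set V := {y | G.resistance x y < r}

theorem vertexWeight_pos [Nontrivial V] (G : WeightedGraph V) (x : V) : 0 < G.vertexWeight x := by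
  obtain ⟨y, hy⟩ := exists_ne x
  rcases (G.connected x y).cases_head with h | ⟨z, hz, -⟩
  · exact absurd h.symm hy
  · exact hz.trans_le
      (Finset.single_le_sum (fun w _ => G.weight_nonneg x w) (Finset.mem_univ z))

/-- The transition probabilities `P(x, y) = μ_{xy} / μ_x` of the random walk. -/
def transition (G : WeightedGraph V) (x y : V) : ℝ := G.weight x y / G.vertexWeight x

theorem sum_transition [Nontrivial V] (G : WeightedGraph V) (x : V) :
    ∑ y, ENNReal.ofReal (G.transition x y) = 1 := by
  have h : ∑ y, G.transition x y = 1 := by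
    simp only [transition]
    rw [← Finset.sum_div]
    exact div_self (G.vertexWeight_pos x).ne'
  have h0 : ∀ y ∈ Finset.univ, 0 ≤ G.transition x y :=
    fun y _ => div_nonneg (G.weight_nonneg x y) (G.vertexWeight_pos x).le
  rw [← ENNReal.ofReal_sum_of_nonneg h0, h, ENNReal.ofReal_one]

/-- The distribution `P(x, ·)` of a step of the random walk from `x`. -/
def stepPMF [Nontrivial V] (G : WeightedGraph V) (x : V) : PMF V :=
  PMF.ofFintype (fun y => ENNReal.ofReal (G.transition x y)) (G.sum_transition x)

variable [Nontrivial V] [MeasurableSpace V] [DiscreteMeasurableSpace V]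

/-- The kernel giving the next position, as a function of the path up to time `n`. -/
def stepKernel (G : WeightedGraph V) (n : ℕ) : Kernel (Finset.Iic n → V) V where
  toFun := fun path => (G.stepPMF (path ⟨n, Finset.mem_Iic.2 le_rfl⟩)).toMeasure
  measurable' := (Measurable.of_discrete (f := fun x : V => (G.stepPMF x).toMeasure)).comp
    (measurable_pi_apply _)

instance (G : WeightedGraph V) (n : ℕ) : IsMarkovKernel (G.stepKernel n) :=
  ⟨fun _ => PMF.toMeasure.isProbabilityMeasure _⟩

/-- The law `𝐏_z` on the path space `V^ℕ` of the discrete time random walk started at `z`. -/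
def walkLaw (G : WeightedGraph V) (z : V) : Measure (ℕ → V) :=
  Kernel.traj (X := fun _ : ℕ => V) G.stepKernel 0 (fun _ => z)

end WeightedGraph

namespace WeightedGraph

variable {V : Type*} [Fintype V]

open Classical in
/-- The local time `L_t(x) = μ_x⁻¹ ∑_{i < t} 1_{X_i = x}` of the path `X`. -/
def localTime (G : WeightedGraph V) (X : ℕ → V) (t : ℕ) (x : V) : ℝ :=
  (G.vertexWeight x)⁻¹ * ∑ i ∈ Finset.range t, if X i = x then 1 else 0

/-- The maximum, over vertices `x`, `y` and integer times `0 ≤ t ≤ T m(G) r(G)`, of the ratio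
`r(G)⁻¹ |L_t(x) - L_t(y)| / √(R̃(x, y) (1 + ln R̃(x, y)⁻¹))` along the path `X`. For `x = y` the
ratio is `0 / 0 = 0`. The suprema are over finite non-empty sets when `V` is non-empty. -/
def maxLocalTimeRatio (G : WeightedGraph V) (T : ℝ) (X : ℕ → V) : ℝ :=
  ⨆ x : V, ⨆ y : V, ⨆ t : {t : ℕ // (t : ℝ) ≤ T * G.totalMass * G.resistanceDiam},
    G.resistanceDiam⁻¹ * |G.localTime X t x - G.localTime X t y| /
      √(G.scaledResistance x y * (1 + Real.log (G.scaledResistance x y)⁻¹))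

/-- Uniform volume growth with volume doubling for a collection of weighted graphs. The function
`v : ℝ₊ → ℝ₊` is represented by a function on `ℝ` of which only the values on `[0, ∞)` matter. -/
def UVD {I : Type*} {V : I → Type*} [∀ i, Fintype (V i)] (G : ∀ i, WeightedGraph (V i)) : Prop :=
  ∃ (c₁ c₂ c₃ : ℝ) (v : ℝ → ℝ), 0 < c₁ ∧ 0 < c₂ ∧ 0 < c₃ ∧
    (∀ r, 0 ≤ r → 0 ≤ v r) ∧ MonotoneOn v (Set.Ici 0) ∧ (∀ r, 0 ≤ r → v (2 * r) ≤ c₃ * v r) ∧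
    (∀ i, ∀ x : V i, ∀ r ∈ Set.Icc (G i).minResistance (G i).resistanceDiam,
      c₁ * v r ≤ (G i).vol ((G i).resistanceBall x r)) ∧
    (∀ i, (G i).totalMass ≤ c₂ * v (G i).resistanceDiam)

end WeightedGraph

end

/-! For `x ≠ y` let `f` be the potential of the unit current from `x` to `y` with `f y = 0`; then `f
x = R(x, y)` and `0 ≤ f ≤ R(x, y)`. Since `f` is harmonic off `{x, y}`, for every `θ ≥ 0` the
process `exp(θ (L_t(x) - L_t(y)) - θ² R(x, y) L_t(x)) (1 + θ f(X_t))` is a non-negative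
supermartingale (`exp_mul_sum_transition_le`). Ville's inequality bounds by `(1 + θ R) e^{-u}` the
probability that the exponent ever reaches `u` (`walkLaw_exists_localTime_sub_ge_le`). This is a
Gaussian-type bound on increments, uniform in time, whose variance involves the local time itself.

Volume doubling yields `4⁻ᵏ r(G)`-nets of at most `C qᵏ` points, with `C` and `q` independent of the
graph (`UVD.exists_isNetSequence`). A union bound over close pairs of net points at all levels, with
thresholds `u k = lam + κ k` and `κ = 2 ln(2 q²)`, costs `O(e^{-lam/2})`
(`IsNetSequence.walkLaw_largeIncrement_le`).

Off the exceptional events the argument is deterministic chaining, used twice. With a small constant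
parameter `β = 1/54`, the oscillation of `L_t` is at most half of its maximum plus `O(lam r(G))`. As
some vertex has local time at most the average `t / m(G) ≤ T r(G)`, the maximum is `O((T + lam)
r(G))` (`IsNetSequence.localTime_le`). With the variance thus controlled, the choice `β k = √(u k)`
gives increments of order `2⁻ᵏ √(u k) r(G)` at level `k`, which chain to the stated modulus
(`IsNetSequence.abs_localTime_sub_le`). -/

noncomputable section

namespace WeightedGraph

/-! ### Potentials of unit currents and the resistance metric -/

section Resistance

variable {V : Type*} [Fintype V]

/-- The unnormalised Laplacian `∑_v μ_{wv} (f w - f v)`. -/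
def laplacian (G : WeightedGraph V) (f : V → ℝ) (w : V) : ℝ := ∑ v, G.weight w v * (f w - f v)

theorem dirichletForm_eq_sum_laplacian (G : WeightedGraph V) (f g : V → ℝ) :
    G.dirichletForm f g = ∑ w, G.laplacian f w * g w := by
  have h1 : ∑ w, G.laplacian f w * g w = ∑ x, ∑ y, G.weight x y * (f x - f y) * g x := by
    simp only [laplacian, Finset.sum_mul]
  have h2 : ∑ w, G.laplacian f w * g w = ∑ x, ∑ y, G.weight x y * (f y - f x) * g y := by
    rw [h1, Finset.sum_comm]
    refine Finset.sum_congr rfl fun x _ => Finset.sum_congr rfl fun y _ => ?_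
    rw [G.weight_symm]
  have h3 : ∑ x, ∑ y, (f x - f y) * (g x - g y) * G.weight x y
      = ∑ w, G.laplacian f w * g w + ∑ w, G.laplacian f w * g w := by
    nth_rw 1 [h1]
    rw [h2]
    simp only [← Finset.sum_add_distrib]
    refine Finset.sum_congr rfl fun x _ => Finset.sum_congr rfl fun y _ => ?_
    ring
  rw [dirichletForm, h3]
  ring

theorem dirichletForm_self_nonneg (G : WeightedGraph V) (f : V → ℝ) :
    0 ≤ G.dirichletForm f f := by
  refine mul_nonneg (by norm_num) (Finset.sum_nonneg fun x _ => Finset.sum_nonneg fun y _ => ?_)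
  exact mul_nonneg (mul_self_nonneg _) (G.weight_nonneg x y)

theorem eq_of_dirichletForm_self_nonpos (G : WeightedGraph V) {f : V → ℝ}
    (hf : G.dirichletForm f f ≤ 0) (x y : V) : f x = f y := by
  have hnn : ∀ x y, 0 ≤ (f x - f y) * (f x - f y) * G.weight x y := fun x y =>
    mul_nonneg (mul_self_nonneg _) (G.weight_nonneg x y)
  have h0 : ∑ x, ∑ y, (f x - f y) * (f x - f y) * G.weight x y = 0 := by
    refine le_antisymm ?_ (Finset.sum_nonneg fun x _ => Finset.sum_nonneg fun y _ => hnn x y)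
    rw [dirichletForm] at hf
    linarith
  have h1 : ∀ a b, 0 < G.weight a b → f a = f b := by
    intro a b hab
    have h2 := (Finset.sum_eq_zero_iff_of_nonneg
      (fun x _ => Finset.sum_nonneg fun y _ => hnn x y)).1 h0 a (Finset.mem_univ a)
    have h3 := (Finset.sum_eq_zero_iff_of_nonneg (fun y _ => hnn a y)).1 h2 b (Finset.mem_univ b)
    rcases mul_eq_zero.1 h3 with h | h
    · exact sub_eq_zero.1 (mul_self_eq_zero.1 h)
    · exact absurd h hab.ne'
  induction G.connected x y with
  | refl => rfl
  | tail _ hbc ih => exact ih.trans (h1 _ _ hbc)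

theorem dirichletForm_add_smul_self (G : WeightedGraph V) (f h : V → ℝ) (c : ℝ) :
    G.dirichletForm (fun w => f w + c * h w) (fun w => f w + c * h w)
      = G.dirichletForm f f + 2 * c * G.dirichletForm f h + c ^ 2 * G.dirichletForm h h := by
  simp only [dirichletForm, Finset.mul_sum, ← Finset.sum_add_distrib]
  refine Finset.sum_congr rfl fun x _ => Finset.sum_congr rfl fun y _ => ?_
  ring

theorem sum_laplacian (G : WeightedGraph V) (f : V → ℝ) : ∑ w, G.laplacian f w = 0 := by
  have := G.dirichletForm_eq_sum_laplacian f (fun _ => 1)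
  simpa [dirichletForm] using this.symm

open Classical in
/-- `f` is a potential of the unit current from `x` to `y`. -/
def IsPotential (G : WeightedGraph V) (x y : V) (f : V → ℝ) : Prop :=
  ∀ w, G.laplacian f w = (if w = x then 1 else 0) - (if w = y then 1 else 0)

/-- The Laplacian kills constants, so the term `f y` is added at `y`. The resulting operator `Φ`
satisfies `⟨Φ f, f⟩ = 𝓔(f, f) + f(y)²`, hence is injective and so surjective. Summing the solved
equation over all vertices forces `f y = 0`, and the added term disappears. -/
theorem exists_isPotential (G : WeightedGraph V) (x y : V) :
    ∃ f, G.IsPotential x y f ∧ f y = 0 := by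
  classical
  let Φ : (V → ℝ) →ₗ[ℝ] (V → ℝ) :=
    { toFun := fun f w => G.laplacian f w + f y * (if w = y then 1 else 0)
      map_add' := by
        intro f g
        ext w
        simp only [laplacian, Pi.add_apply]
        have : ∑ v, G.weight w v * (f w + g w - (f v + g v))
            = ∑ v, G.weight w v * (f w - f v) + ∑ v, G.weight w v * (g w - g v) := by
          rw [← Finset.sum_add_distrib]
          exact Finset.sum_congr rfl fun v _ => by ring
        rw [this]
        ring
      map_smul' := by
        intro c f
        ext w
        simp only [laplacian, Pi.smul_apply, smul_eq_mul, RingHom.id_apply]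
        have : ∑ v, G.weight w v * (c * f w - c * f v)
            = c * ∑ v, G.weight w v * (f w - f v) := by
          rw [Finset.mul_sum]
          exact Finset.sum_congr rfl fun v _ => by ring
        rw [this]
        ring }
  have hinj : Function.Injective Φ := by
    rw [← LinearMap.ker_eq_bot, LinearMap.ker_eq_bot']
    intro f hf
    have h1 : ∑ w, Φ f w * f w = 0 := by simp [hf]
    have h2 : ∑ w, Φ f w * f w = G.dirichletForm f f + f y * f y := by
      rw [dirichletForm_eq_sum_laplacian]
      simp [Φ, add_mul, Finset.sum_add_distrib]
    have h3 := G.dirichletForm_self_nonneg f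
    have h4 := mul_self_nonneg (f y)
    have h5 : f y = 0 := mul_self_eq_zero.1 (by linarith)
    ext w
    rw [G.eq_of_dirichletForm_self_nonpos (by linarith : G.dirichletForm f f ≤ 0) w y, h5]
    rfl
  obtain ⟨f, hf⟩ := LinearMap.injective_iff_surjective.1 hinj
    (fun w => (if w = x then 1 else 0) - (if w = y then 1 else 0))
  have hfw : ∀ w, G.laplacian f w + f y * (if w = y then 1 else 0)
      = (if w = x then 1 else 0) - (if w = y then 1 else 0) := fun w => congrFun hf w
  have hfy : f y = 0 := by
    have h1 : ∑ w, (G.laplacian f w + f y * (if w = y then 1 else 0)) = 0 := by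
      rw [Finset.sum_congr rfl fun w _ => hfw w]
      simp
    rw [Finset.sum_add_distrib, G.sum_laplacian] at h1
    simpa using h1
  exact ⟨f, fun w => by simpa [hfy] using hfw w, hfy⟩

namespace IsPotential

variable {G : WeightedGraph V} {x y z : V} {f g : V → ℝ}

theorem dirichletForm_eq (hf : G.IsPotential x y f) (h : V → ℝ) :
    G.dirichletForm f h = h x - h y := by
  classical
  rw [dirichletForm_eq_sum_laplacian, Finset.sum_congr rfl fun w _ => by rw [hf w]]
  simp [sub_mul]

theorem neg (hf : G.IsPotential x y f) : G.IsPotential y x (fun w => -f w) := by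
  intro w
  have h1 : G.laplacian (fun w => -f w) w = -G.laplacian f w := by
    rw [laplacian, laplacian, ← Finset.sum_neg_distrib]
    exact Finset.sum_congr rfl fun v _ => by ring
  rw [h1, hf w]
  ring

theorem add (hf : G.IsPotential x y f) (hg : G.IsPotential y z g) :
    G.IsPotential x z (fun w => f w + g w) := by
  intro w
  have h1 : G.laplacian (fun w => f w + g w) w = G.laplacian f w + G.laplacian g w := by
    rw [laplacian, laplacian, laplacian, ← Finset.sum_add_distrib]
    exact Finset.sum_congr rfl fun v _ => by ring
  rw [h1, hf w, hg w]
  ring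

/-- Minimum principle by truncation: for `h = min (f - f y) 0`, `𝓔(h, h) ≤ 𝓔(f, h) = h x - h y ≤ 0`,
so `h` is constant and equal to `h y = 0`. -/
theorem apply_right_le (hf : G.IsPotential x y f) (w : V) : f y ≤ f w := by
  set h : V → ℝ := fun w => min (f w - f y) 0 with hh
  have h1 : G.dirichletForm h h ≤ G.dirichletForm f h := by
    refine mul_le_mul_of_nonneg_left (Finset.sum_le_sum fun a _ => Finset.sum_le_sum fun b _ => ?_)
      (by norm_num)
    refine mul_le_mul_of_nonneg_right ?_ (G.weight_nonneg a b)
    simp only [hh]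
    rcases le_total (f a - f y) 0 with ha | ha <;> rcases le_total (f b - f y) 0 with hb | hb <;>
      simp only [min_eq_left, min_eq_right, ha, hb] <;> nlinarith
  have hy : h y = 0 := by simp [hh]
  have hx : h x ≤ 0 := min_le_right _ _
  rw [hf.dirichletForm_eq, hy, sub_zero] at h1
  have h2 := G.eq_of_dirichletForm_self_nonpos (h1.trans hx) w y
  rw [hy] at h2
  have h3 : h w ≤ f w - f y := min_le_left _ _
  linarith

theorem le_apply_left (hf : G.IsPotential x y f) (w : V) : f w ≤ f x := by
  have := hf.neg.apply_right_le w
  linarith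

theorem apply_right_lt (hf : G.IsPotential x y f) (hxy : x ≠ y) : f y < f x := by
  classical
  refine lt_of_le_of_ne (hf.apply_right_le x) fun h0 => ?_
  -- If `f x = f y` then `f` is constant, contradicting `𝓔(f, 1_{x}) = 1`.
  have hE : G.dirichletForm f f = 0 := by rw [hf.dirichletForm_eq, h0, sub_self]
  have h2 := hf.dirichletForm_eq (fun w => if w = x then 1 else 0)
  have h3 : ∀ a b, f a = f b := G.eq_of_dirichletForm_self_nonpos hE.le
  simp [dirichletForm, fun a b => sub_eq_zero.2 (h3 a b), hxy.symm] at h2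

theorem resistance_eq (hf : G.IsPotential x y f) : G.resistance x y = f x - f y := by
  classical
  by_cases hxy : x = y
  · simp [resistance, hxy]
  rw [resistance, if_neg hxy, effectiveResistance]
  set ρ := f x - f y with hρ
  have hE : G.dirichletForm f f = ρ := hf.dirichletForm_eq f
  have hρpos : 0 < ρ := sub_pos.2 (hf.apply_right_lt hxy)
  have key : IsLeast {e : ℝ | ∃ f : V → ℝ, (∀ a ∈ ({x} : Set V), f a = 0) ∧
      (∀ b ∈ ({y} : Set V), f b = 1) ∧ e = G.dirichletForm f f} ρ⁻¹ := by
    constructor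
    · refine ⟨fun w => ρ⁻¹ * (f x - f w), ?_, ?_, ?_⟩
      · rintro a rfl
        simp
      · rintro b rfl
        exact inv_mul_cancel₀ hρpos.ne'
      · have : G.dirichletForm (fun w => ρ⁻¹ * (f x - f w)) (fun w => ρ⁻¹ * (f x - f w))
            = ρ⁻¹ ^ 2 * G.dirichletForm f f := by
          simp only [dirichletForm, Finset.mul_sum]
          refine Finset.sum_congr rfl fun x _ => Finset.sum_congr rfl fun y _ => ?_
          ring
        rw [this, hE]
        field_simp
    · rintro e ⟨h, h0, h1, rfl⟩
      -- For a competitor `h`, `𝓔(f, h) = h x - h y = -1`. Hence `0 ≤ 𝓔(f + ρ h, f + ρ h) = ρ - 2ρ +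
      -- ρ² 𝓔(h, h)`, that is, `𝓔(h, h) ≥ ρ⁻¹`.
      have h2 := G.dirichletForm_self_nonneg (fun w => f w + ρ * h w)
      rw [dirichletForm_add_smul_self, hE, hf.dirichletForm_eq, h0 x rfl, h1 y rfl] at h2
      rw [inv_le_iff_one_le_mul₀ hρpos]
      have h3 : 0 ≤ ρ * (G.dirichletForm h h * ρ - 1) := by linarith
      have := nonneg_of_mul_nonneg_right h3 hρpos
      linarith
  rw [key.csInf_eq, inv_inv]

end IsPotential

variable (G : WeightedGraph V)

theorem resistance_self (x : V) : G.resistance x x = 0 := by simp [resistance]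

theorem resistance_nonneg (x y : V) : 0 ≤ G.resistance x y := by
  obtain ⟨f, hf, -⟩ := G.exists_isPotential x y
  rw [hf.resistance_eq, sub_nonneg]
  exact hf.apply_right_le x

theorem resistance_comm (x y : V) : G.resistance x y = G.resistance y x := by
  obtain ⟨f, hf, -⟩ := G.exists_isPotential x y
  rw [hf.resistance_eq, hf.neg.resistance_eq]
  ring

theorem resistance_pos {x y : V} (hxy : x ≠ y) : 0 < G.resistance x y := by
  obtain ⟨f, hf, -⟩ := G.exists_isPotential x y
  rw [hf.resistance_eq, sub_pos]
  exact hf.apply_right_lt hxy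

theorem resistance_triangle (x y z : V) :
    G.resistance x z ≤ G.resistance x y + G.resistance y z := by
  obtain ⟨f, hf, -⟩ := G.exists_isPotential x y
  obtain ⟨g, hg, -⟩ := G.exists_isPotential y z
  rw [(hf.add hg).resistance_eq, hf.resistance_eq, hg.resistance_eq]
  have h1 := hf.apply_right_le z
  have h2 := hg.le_apply_left x
  linarith

theorem resistance_le_resistanceDiam (x y : V) : G.resistance x y ≤ G.resistanceDiam :=
  (le_ciSup (f := fun y => G.resistance x y) (Set.finite_range _).bddAbove y).trans
    (le_ciSup (f := fun x => ⨆ y, G.resistance x y) (Set.finite_range _).bddAbove x)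

theorem minResistance_le {x y : V} (hxy : x ≠ y) : G.minResistance ≤ G.resistance x y :=
  ciInf_le (f := fun p : {p : V × V // p.1 ≠ p.2} => G.resistance p.1.1 p.1.2)
    (Set.finite_range _).bddBelow ⟨(x, y), hxy⟩

theorem minResistance_nonneg : 0 ≤ G.minResistance :=
  Real.iInf_nonneg fun _ => G.resistance_nonneg _ _

theorem resistanceDiam_pos [Nontrivial V] : 0 < G.resistanceDiam := by
  obtain ⟨x, y, hxy⟩ := exists_pair_ne V
  exact (G.resistance_pos hxy).trans_le (G.resistance_le_resistanceDiam x y)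

theorem minResistance_le_resistanceDiam [Nontrivial V] :
    G.minResistance ≤ G.resistanceDiam := by
  obtain ⟨x, y, hxy⟩ := exists_pair_ne V
  exact (G.minResistance_le hxy).trans (G.resistance_le_resistanceDiam x y)

theorem vertexWeight_nonneg (x : V) : 0 ≤ G.vertexWeight x :=
  Finset.sum_nonneg fun y _ => G.weight_nonneg x y

theorem totalMass_eq : G.totalMass = ∑ x, G.vertexWeight x := by
  simp [totalMass, vol]

theorem totalMass_pos [Nontrivial V] : 0 < G.totalMass := by
  rw [totalMass_eq]
  exact Finset.sum_pos (fun x _ => G.vertexWeight_pos x) Finset.univ_nonempty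

theorem sum_vol_le_totalMass {ι : Type*} (s : Finset ι) (A : ι → Set V)
    (hA : (s : Set ι).PairwiseDisjoint A) : ∑ i ∈ s, G.vol (A i) ≤ G.totalMass := by
  classical
  rw [totalMass_eq]
  simp only [vol]
  rw [Finset.sum_comm]
  refine Finset.sum_le_sum fun x _ => ?_
  rw [← Finset.indicator_biUnion_apply s A hA]
  exact Set.indicator_le_self' (fun _ _ => G.vertexWeight_nonneg _) x

end Resistance

/-! ### One-step supermartingale inequality -/

section Transition

variable {V : Type*} [Fintype V] [Nontrivial V] (G : WeightedGraph V)

theorem sum_transition_real (w : V) : ∑ v, G.transition w v = 1 := by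
  simp only [transition]
  rw [← Finset.sum_div]
  exact div_self (G.vertexWeight_pos w).ne'

theorem transition_nonneg (w v : V) : 0 ≤ G.transition w v :=
  div_nonneg (G.weight_nonneg w v) (G.vertexWeight_pos w).le

theorem sum_transition_mul (f : V → ℝ) (w : V) :
    ∑ v, G.transition w v * f v = f w - G.laplacian f w / G.vertexWeight w := by
  have h1 : G.laplacian f w / G.vertexWeight w
      = ∑ v, (G.transition w v * f w - G.transition w v * f v) := by
    rw [laplacian, Finset.sum_div]
    exact Finset.sum_congr rfl fun v _ => by rw [transition]; ring
  rw [h1, Finset.sum_sub_distrib, ← Finset.sum_mul, G.sum_transition_real]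
  ring

-- One step of the walk changes the mean of `1 + θ f` only at `x` and `y`. Write `s = μ_w⁻¹`. At `w
-- = x` the mean is `1 + θ f x - θ s ≤ (1 + θ f x) exp(-θ s / (1 + θ f x))`, and `(1 - θ f x)(1 + θ
-- f x) ≤ 1` is why the correction `θ² f x` suffices. At `w = y` the claim is `1 + θ s ≤ e^{θ s}`.
open Classical in
theorem exp_mul_sum_transition_le {x y : V} (hxy : x ≠ y) {f : V → ℝ} (hf : G.IsPotential x y f)
    (hfy : f y = 0) {θ : ℝ} (hθ : 0 ≤ θ) (w : V) :
    Real.exp ((G.vertexWeight w)⁻¹ * ((θ - θ ^ 2 * f x) * (if w = x then 1 else 0)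
      - θ * (if w = y then 1 else 0))) * ∑ v, G.transition w v * (1 + θ * f v)
      ≤ 1 + θ * f w := by
  have h1 : ∑ v, G.transition w v * (1 + θ * f v)
      = 1 + θ * f w - θ * (G.laplacian f w / G.vertexWeight w) := by
    have := G.sum_transition_mul f w
    have h2 : ∑ v, G.transition w v * (1 + θ * f v)
        = ∑ v, G.transition w v + θ * ∑ v, G.transition w v * f v := by
      rw [Finset.mul_sum, ← Finset.sum_add_distrib]
      exact Finset.sum_congr rfl fun v _ => by ring
    rw [h2, this, G.sum_transition_real]
    ring
  have hμ := inv_pos.2 (G.vertexWeight_pos w)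
  rw [h1, hf w]
  by_cases hwx : w = x
  · subst hwx
    simp only [if_true, hxy, if_false, mul_one, mul_zero, sub_zero, one_div]
    set s := (G.vertexWeight w)⁻¹
    have hR : 0 ≤ θ * f w := mul_nonneg hθ (hfy ▸ hf.apply_right_le w)
    have ha : 0 < 1 + θ * f w := by linarith
    have h3 : 1 + θ * f w - θ * s ≤ (1 + θ * f w) * Real.exp (-(θ * s / (1 + θ * f w))) := by
      have := Real.add_one_le_exp (-(θ * s / (1 + θ * f w)))
      calc 1 + θ * f w - θ * s = (1 + θ * f w) * (-(θ * s / (1 + θ * f w)) + 1) := by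
            field_simp; ring
        _ ≤ _ := mul_le_mul_of_nonneg_left this ha.le
    calc Real.exp (s * (θ - θ ^ 2 * f w)) * (1 + θ * f w - θ * s)
        ≤ Real.exp (s * (θ - θ ^ 2 * f w)) *
          ((1 + θ * f w) * Real.exp (-(θ * s / (1 + θ * f w)))) :=
          mul_le_mul_of_nonneg_left h3 (Real.exp_pos _).le
      _ = (1 + θ * f w) * Real.exp (s * (θ - θ ^ 2 * f w) - θ * s / (1 + θ * f w)) := by
          rw [sub_eq_add_neg (s * _), Real.exp_add]; ring
      _ ≤ (1 + θ * f w) * 1 := by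
          refine mul_le_mul_of_nonneg_left (Real.exp_le_one_iff.2 ?_) ha.le
          rw [sub_nonpos, le_div_iff₀ ha]
          have : 0 ≤ θ * s * (θ * f w) ^ 2 := by positivity
          nlinarith
      _ = _ := mul_one _
  · by_cases hwy : w = y
    · subst hwy
      simp only [if_true, hwx, if_false, mul_one, mul_zero, zero_sub, hfy, add_zero]
      have := Real.add_one_le_exp (θ * (G.vertexWeight w)⁻¹)
      rw [show (G.vertexWeight w)⁻¹ * -θ = -(θ * (G.vertexWeight w)⁻¹) by ring, Real.exp_neg,
        inv_mul_le_iff₀ (Real.exp_pos _)]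
      have h4 : -1 / G.vertexWeight w = -(G.vertexWeight w)⁻¹ := by rw [neg_div, one_div]
      rw [h4]
      linarith
    · simp [hwx, hwy]

end Transition

/-! ### Markov property, Ville's inequality and the increment tail bound -/

theorem measurable_of_dependsOn_le {V : Type*} [Finite V] [MeasurableSpace V]
    [DiscreteMeasurableSpace V] {α : Type*} [MeasurableSpace α] {n : ℕ} {H : (ℕ → V) → α}
    (hH : ∀ X Y : ℕ → V, (∀ i ≤ n, X i = Y i) → H X = H Y) :
    ∃ h : (Finset.Iic n → V) → α, Measurable h ∧
      ∀ X, H X = h (Preorder.frestrictLe (π := fun _ : ℕ => V) n X) := by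
  refine ⟨fun p => H fun i => p ⟨min i n, Finset.mem_Iic.2 (min_le_right _ _)⟩,
    Measurable.of_discrete, fun X => hH _ _ fun i hi => ?_⟩
  simp [min_eq_left hi]

section Walk

variable {V : Type*} [Fintype V] [Nontrivial V] [MeasurableSpace V] [DiscreteMeasurableSpace V]
  (G : WeightedGraph V)

instance (z : V) : IsProbabilityMeasure (G.walkLaw z) := by
  unfold walkLaw
  infer_instance

theorem lintegral_stepPMF (g : V → ENNReal) (w : V) :
    ∫⁻ v, g v ∂(G.stepPMF w).toMeasure = ∑ v, g v * ENNReal.ofReal (G.transition w v) := by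
  rw [lintegral_fintype]
  refine Finset.sum_congr rfl fun v _ => ?_
  rw [PMF.toMeasure_apply_singleton _ _ (measurableSet_singleton v)]
  rfl

theorem lintegral_walkLaw_zero (z : V) (g : V → ENNReal) :
    ∫⁻ X, g (X 0) ∂G.walkLaw z = g z := by
  have h1 : ∫⁻ X, g (X 0) ∂G.walkLaw z = ∫⁻ p, g (p ⟨0, Finset.mem_Iic.2 le_rfl⟩)
      ∂((G.walkLaw z).map (Preorder.frestrictLe (π := fun _ : ℕ => V) 0)) := by
    rw [lintegral_map Measurable.of_discrete (by fun_prop)]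
    rfl
  rw [h1, walkLaw, Kernel.traj_map_frestrictLe_apply, Kernel.partialTraj_zero,
    Kernel.lintegral_deterministic' _ Measurable.of_discrete]
  rfl

/-- The Markov property at time `n`. -/
theorem lintegral_walkLaw_mul_succ (z : V) (n : ℕ) {H : (ℕ → V) → ENNReal}
    (hH : ∀ X Y : ℕ → V, (∀ i ≤ n, X i = Y i) → H X = H Y) (g : V → ENNReal) :
    ∫⁻ X, H X * g (X (n + 1)) ∂G.walkLaw z
      = ∫⁻ X, H X * ∫⁻ v, g v ∂(G.stepPMF (X n)).toMeasure ∂G.walkLaw z := by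
  obtain ⟨h, hm, hh⟩ := measurable_of_dependsOn_le hH
  have hg : Measurable g := Measurable.of_discrete
  have h1 : ∫⁻ X, H X * g (X (n + 1)) ∂G.walkLaw z = ∫⁻ p, h p.1 * g p.2
      ∂((G.walkLaw z).map fun X =>
        (Preorder.frestrictLe (π := fun _ : ℕ => V) n X, X (n + 1))) := by
    rw [lintegral_map (by fun_prop) (by fun_prop)]
    simp only [hh]
  have h2 : ∫⁻ X, H X * ∫⁻ v, g v ∂(G.stepPMF (X n)).toMeasure ∂G.walkLaw z
      = ∫⁻ p, h p * ∫⁻ v, g v ∂(G.stepKernel n p)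
        ∂((G.walkLaw z).map (Preorder.frestrictLe (π := fun _ : ℕ => V) n)) := by
    rw [lintegral_map Measurable.of_discrete (by fun_prop)]
    simp only [hh]
    rfl
  rw [h1, h2, walkLaw, Kernel.traj_map_frestrictLe_apply,
    ← Kernel.partialTraj_compProd_eq_map_traj (X := fun _ : ℕ => V) (κ := G.stepKernel)
      (Nat.zero_le n) (x₀ := fun _ => z),
    Measure.lintegral_compProd (by fun_prop)]
  refine lintegral_congr fun p => ?_
  exact lintegral_const_mul (h p) hg

/-- Ville's maximal inequality for the non-negative supermartingale
`(∏_{i < t} ψ (X i)) * g (X t)`. -/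
theorem mul_walkLaw_exists_le (z : V) (g ψ : V → ENNReal)
    (hg : ∀ w, ψ w * ∫⁻ v, g v ∂(G.stepPMF w).toMeasure ≤ g w) (a : ENNReal) (n : ℕ) :
    a * G.walkLaw z {X | ∃ t ≤ n, a ≤ (∏ i ∈ Finset.range t, ψ (X i)) * g (X t)} ≤ g z := by
  classical
  set N : ℕ → (ℕ → V) → ENNReal := fun t X => (∏ i ∈ Finset.range t, ψ (X i)) * g (X t) with hN
  set A : ℕ → Set (ℕ → V) := fun n => {X | ∃ t ≤ n, a ≤ N t X} with hA
  have hNdep : ∀ t n, t ≤ n → ∀ X Y : ℕ → V, (∀ i ≤ n, X i = Y i) → N t X = N t Y := by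
    intro t n htn X Y h
    simp only [hN]
    rw [h t htn]
    congr 1
    exact Finset.prod_congr rfl fun i hi => by
      rw [h i ((Finset.mem_range.1 hi).le.trans htn)]
  have hAdep : ∀ n, ∀ X Y : ℕ → V, (∀ i ≤ n, X i = Y i) → (X ∈ A n ↔ Y ∈ A n) := by
    intro n X Y h
    simp only [hA, Set.mem_ofPred_eq]
    exact exists_congr fun t => and_congr_right fun ht => by rw [hNdep t n ht X Y h]
  have meas : ∀ n, ∀ H : (ℕ → V) → ENNReal,
      (∀ X Y : ℕ → V, (∀ i ≤ n, X i = Y i) → H X = H Y) → Measurable H := by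
    intro n H hH
    obtain ⟨h, hm, hh⟩ := measurable_of_dependsOn_le hH
    rw [funext hh]
    fun_prop
  -- The integrand is bounded by the process stopped when it first reaches `a`, with its value there
  -- lowered to `a`; its mean does not increase with `n`.
  have main : ∀ n, ∫⁻ X, (if X ∈ A n then a else N n X) ∂G.walkLaw z ≤ g z := by
    intro n
    induction n with
    | zero =>
      refine le_trans (lintegral_mono fun X => ?_) (G.lintegral_walkLaw_zero z g).le
      split_ifs with h
      · obtain ⟨t, ht, hle⟩ := h
        obtain rfl : t = 0 := by omega
        simpa [hN] using hle
      · simp [hN]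
    | succ n ih =>
      refine le_trans ?_ ih
      have e1 : ∫⁻ X, (if X ∈ A (n + 1) then a else N (n + 1) X) ∂G.walkLaw z
          ≤ ∫⁻ X, ((if X ∈ A n then a else 0) +
            (if X ∈ A n then 0 else ∏ i ∈ Finset.range (n + 1), ψ (X i)) * g (X (n + 1)))
            ∂G.walkLaw z := by
        refine lintegral_mono fun X => ?_
        by_cases h : X ∈ A n
        · have : X ∈ A (n + 1) := by
            obtain ⟨t, ht, hle⟩ := h
            exact ⟨t, ht.trans n.le_succ, hle⟩
          simp [h, this]
        · simp only [h, if_false, zero_add]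
          split_ifs with h'
          · obtain ⟨t, ht, hle⟩ := h'
            rcases Nat.le_succ_iff.1 ht with ht | rfl
            · exact absurd ⟨t, ht, hle⟩ h
            · exact hle
          · exact le_rfl
      have d1 : ∀ X Y : ℕ → V, (∀ i ≤ n, X i = Y i) →
          (if X ∈ A n then a else 0) = (if Y ∈ A n then a else 0) := fun X Y h => by
        simp only [hAdep n X Y h]
      have d2 : ∀ X Y : ℕ → V, (∀ i ≤ n, X i = Y i) →
          (if X ∈ A n then 0 else ∏ i ∈ Finset.range (n + 1), ψ (X i))
            = (if Y ∈ A n then 0 else ∏ i ∈ Finset.range (n + 1), ψ (Y i)) := fun X Y h => by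
        simp only [hAdep n X Y h]
        split_ifs
        · rfl
        · exact Finset.prod_congr rfl fun i hi => by
            rw [h i (Nat.lt_succ_iff.1 (Finset.mem_range.1 hi))]
      refine e1.trans ?_
      rw [lintegral_add_left (meas n _ d1), G.lintegral_walkLaw_mul_succ z n d2,
        ← lintegral_add_left (meas n _ d1)]
      refine lintegral_mono fun X => ?_
      by_cases h : X ∈ A n
      · simp [h]
      · simp only [h, if_false, zero_add, hN, Finset.prod_range_succ, mul_assoc]
        exact mul_le_mul_right (hg _) _
  have hmA : MeasurableSet (A n) := by
    have : Measurable fun X => if X ∈ A n then (1 : ENNReal) else 0 :=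
      meas n _ fun X Y h => by simp only [hAdep n X Y h]
    have h1 : A n = (fun X => if X ∈ A n then (1 : ENNReal) else 0) ⁻¹' {1} := by
      ext X
      by_cases h : X ∈ A n <;> simp [h]
    rw [h1]
    exact this (measurableSet_singleton 1)
  calc a * G.walkLaw z (A n) = ∫⁻ X, (A n).indicator (fun _ => a) X ∂G.walkLaw z := by
        rw [lintegral_indicator_const hmA]
    _ ≤ ∫⁻ X, (if X ∈ A n then a else N n X) ∂G.walkLaw z := by
        refine lintegral_mono fun X => ?_
        by_cases h : X ∈ A n <;> simp [h]
    _ ≤ g z := main n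

/-- Ville's inequality for the exponential supermartingale of the potential `f`. The factor `1 + θ
f` is at least `1` at time `t` and at most `1 + θ R(x, y)` at the start. -/
theorem walkLaw_exists_localTime_sub_ge_le (z : V) {x y : V} (hxy : x ≠ y) {θ : ℝ} (hθ : 0 ≤ θ)
    (u : ℝ) (n : ℕ) :
    G.walkLaw z {X | ∃ t ≤ n, u ≤ θ * (G.localTime X t x - G.localTime X t y)
        - θ ^ 2 * G.resistance x y * G.localTime X t x}
      ≤ ENNReal.ofReal ((1 + θ * G.resistance x y) * Real.exp (-u)) := by
  classical
  obtain ⟨f, hf, hfy⟩ := G.exists_isPotential x y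
  have hR : G.resistance x y = f x := by rw [hf.resistance_eq, hfy, sub_zero]
  have hf0 : ∀ w, 0 ≤ f w := fun w => hfy ▸ hf.apply_right_le w
  set φ : V → ℝ := fun w => (G.vertexWeight w)⁻¹ * ((θ - θ ^ 2 * f x) * (if w = x then 1 else 0)
      - θ * (if w = y then 1 else 0)) with hφ
  have hlocal : ∀ X : ℕ → V, ∀ t, ∑ i ∈ Finset.range t, φ (X i)
      = θ * (G.localTime X t x - G.localTime X t y) - θ ^ 2 * f x * G.localTime X t x := by
    intro X t
    simp only [localTime, Finset.mul_sum, ← Finset.sum_sub_distrib, hφ]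
    refine Finset.sum_congr rfl fun i _ => ?_
    by_cases h1 : X i = x
    · have h2 : X i ≠ y := h1 ▸ hxy
      simp [h1, hxy]
      ring
    · by_cases h2 : X i = y
      · simp [h2, hxy.symm]
        ring
      · simp [h1, h2]
  have hnn : ∀ w, 0 ≤ 1 + θ * f w := fun w => by nlinarith [mul_nonneg hθ (hf0 w)]
  have hville := G.mul_walkLaw_exists_le z (fun w => ENNReal.ofReal (1 + θ * f w))
    (fun w => ENNReal.ofReal (Real.exp (φ w))) (fun w => by
      rw [lintegral_stepPMF]
      simp only [← ENNReal.ofReal_mul (hnn _)]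
      rw [← ENNReal.ofReal_sum_of_nonneg
        (fun v _ => mul_nonneg (hnn v) (G.transition_nonneg w v)),
        ← ENNReal.ofReal_mul (Real.exp_pos _).le]
      refine ENNReal.ofReal_le_ofReal ?_
      simp only [mul_comm (1 + θ * f _) (G.transition _ _)]
      exact G.exp_mul_sum_transition_le hxy hf hfy hθ w) (ENNReal.ofReal (Real.exp u)) n
  have hsub : {X : ℕ → V | ∃ t ≤ n, u ≤ θ * (G.localTime X t x - G.localTime X t y)
        - θ ^ 2 * G.resistance x y * G.localTime X t x} ⊆
      {X | ∃ t ≤ n, ENNReal.ofReal (Real.exp u) ≤ (∏ i ∈ Finset.range t,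
        ENNReal.ofReal (Real.exp (φ (X i)))) * ENNReal.ofReal (1 + θ * f (X t))} := by
    rintro X ⟨t, ht, hu⟩
    refine ⟨t, ht, ?_⟩
    rw [← ENNReal.ofReal_prod_of_nonneg (fun _ _ => (Real.exp_pos _).le), ← Real.exp_sum,
      ← ENNReal.ofReal_mul (Real.exp_pos _).le, hlocal]
    refine ENNReal.ofReal_le_ofReal ?_
    rw [hR] at hu
    calc Real.exp u ≤ Real.exp (θ * (G.localTime X t x - G.localTime X t y)
          - θ ^ 2 * f x * G.localTime X t x) * 1 := by rw [mul_one]; exact Real.exp_le_exp.2 hu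
      _ ≤ _ := mul_le_mul_of_nonneg_left (by nlinarith [mul_nonneg hθ (hf0 (X t))])
          (Real.exp_pos _).le
  refine (measure_mono hsub).trans ?_
  have hpos : ENNReal.ofReal (Real.exp u) ≠ 0 := by simp [Real.exp_pos]
  have h5 : ENNReal.ofReal ((1 + θ * G.resistance x y) * Real.exp (-u))
      = ENNReal.ofReal (1 + θ * f x) / ENNReal.ofReal (Real.exp u) := by
    rw [← ENNReal.ofReal_div_of_pos (Real.exp_pos u), hR, Real.exp_neg, div_eq_mul_inv]
  rw [h5, ENNReal.le_div_iff_mul_le (Or.inl hpos) (Or.inl ENNReal.ofReal_ne_top), mul_comm]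
  refine hville.trans (ENNReal.ofReal_le_ofReal ?_)
  have := mul_le_mul_of_nonneg_left (hf.le_apply_left z) hθ
  linarith

end Walk

/-! ### Nets of controlled cardinality -/

section Nets

variable {V : Type*} [Fintype V] (G : WeightedGraph V)

theorem exists_separated_net {δ : ℝ} (hδ : 0 < δ) :
    ∃ A : Finset V, (∀ a ∈ A, ∀ b ∈ A, a ≠ b → δ ≤ G.resistance a b) ∧
      ∀ x, ∃ a ∈ A, G.resistance x a ≤ δ := by
  classical
  obtain ⟨A, hA, hmax⟩ := (Finset.univ.filter fun A : Finset V =>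
    ∀ a ∈ A, ∀ b ∈ A, a ≠ b → δ ≤ G.resistance a b).exists_max_image Finset.card ⟨∅, by simp⟩
  simp only [Finset.mem_filter, Finset.mem_univ, true_and] at hA hmax
  refine ⟨A, hA, fun x => ?_⟩
  by_contra! hx
  have hxA : x ∉ A := fun h => by
    have := hx x h
    rw [G.resistance_self] at this
    linarith
  have := hmax (insert x A) (by
    intro a ha b hb hab
    rcases Finset.mem_insert.1 ha with hax | ha <;> rcases Finset.mem_insert.1 hb with hbx | hb
    · exact absurd (hax.trans hbx.symm) hab
    · exact hax ▸ (hx b hb).le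
    · rw [G.resistance_comm]
      exact hbx ▸ (hx a ha).le
    · exact hA a ha b hb hab)
  rw [Finset.card_insert_of_notMem hxA] at this
  omega

theorem card_separated_mul_le [Nontrivial V] {c : ℝ} {v : ℝ → ℝ} (hc : 0 ≤ c)
    (hv : MonotoneOn v (Set.Ici 0))
    (hvol : ∀ x : V, ∀ r ∈ Set.Icc G.minResistance G.resistanceDiam,
      c * v r ≤ G.vol (G.resistanceBall x r))
    {δ : ℝ} (hδ : 0 ≤ δ) (hδr : δ ≤ G.resistanceDiam) {A : Finset V}
    (hA : ∀ a ∈ A, ∀ b ∈ A, a ≠ b → 2 * δ ≤ G.resistance a b) :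
    A.card * (c * v δ) ≤ G.totalMass := by
  have h0 := G.minResistance_nonneg
  have key : ∃ ρ ∈ Set.Icc G.minResistance G.resistanceDiam, δ ≤ ρ ∧
      (A : Set V).PairwiseDisjoint fun a => G.resistanceBall a ρ := by
    rcases le_total G.minResistance δ with h | h
    · refine ⟨δ, ⟨h, hδr⟩, le_rfl, fun a ha b hb hab => Set.disjoint_left.2 fun y hya hyb => ?_⟩
      have h1 := hA a ha b hb hab
      have h2 := G.resistance_triangle a y b
      have h3 : G.resistance a y < δ := hya
      have h4 : G.resistance b y < δ := hyb
      rw [G.resistance_comm] at h4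
      linarith
    -- The volume bound is not available below `r₀(G)`. There the radius is raised to `r₀(G)`, whose
    -- balls are singletons and so still disjoint.
    · refine ⟨G.minResistance, ⟨le_rfl, G.minResistance_le_resistanceDiam⟩, h,
        fun a _ b _ hab => Set.disjoint_left.2 fun y hya hyb => hab ?_⟩
      have : ∀ a, G.resistance a y < G.minResistance → a = y := fun a ha => by
        by_contra hne
        exact absurd (G.minResistance_le hne) (not_le.2 ha)
      exact (this a hya).trans (this b hyb).symm
  obtain ⟨ρ, hρ, hδρ, hdisj⟩ := key
  refine le_trans ?_ (G.sum_vol_le_totalMass A _ hdisj)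
  rw [← nsmul_eq_mul]
  refine Finset.card_nsmul_le_sum _ _ _ fun a _ => le_trans ?_ (hvol a ρ hρ)
  exact mul_le_mul_of_nonneg_left (hv hδ (hδ.trans hδρ) hδρ) hc

/-- `A k` is a `4⁻ᵏ r(G)`-net of cardinality at most `C qᵏ`, for each `k`. -/
structure IsNetSequence (C q : ℝ) (A : ℕ → Finset V) : Prop where
  exists_near : ∀ k x, ∃ a ∈ A k, G.resistance x a ≤ (1 / 4) ^ k * G.resistanceDiam
  card_le : ∀ k, ((A k).card : ℝ) ≤ C * q ^ k

end Nets

theorem UVD.exists_isNetSequence {I : Type*} {V : I → Type*} [∀ i, Fintype (V i)]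
    [∀ i, Nontrivial (V i)] {G : ∀ i, WeightedGraph (V i)} (hG : UVD G) :
    ∃ C q : ℝ, 0 < C ∧ 1 ≤ q ∧ ∀ i, ∃ A, (G i).IsNetSequence C q A := by
  obtain ⟨c₁, c₂, c₃, v, h₁, h₂, -, hv0, hmono, hdoub, hvol, hm⟩ := hG
  set Q := max c₃ 1 with hQ
  have hQ1 : 1 ≤ Q := le_max_right _ _
  have hdoub' : ∀ r, 0 ≤ r → ∀ j : ℕ, v r ≤ Q ^ j * v (r / 2 ^ j) := by
    intro r hr j
    induction j with
    | zero => simp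
    | succ j ih =>
      have h3 := hdoub (r / 2 ^ (j + 1)) (by positivity)
      have h4 : 2 * (r / 2 ^ (j + 1)) = r / 2 ^ j := by
        rw [pow_succ]
        field_simp
      have h5 : c₃ * v (r / 2 ^ (j + 1)) ≤ Q * v (r / 2 ^ (j + 1)) :=
        mul_le_mul_of_nonneg_right (le_max_left _ _) (hv0 _ (by positivity))
      rw [h4] at h3
      calc v r ≤ Q ^ j * v (r / 2 ^ j) := ih
        _ ≤ Q ^ j * (Q * v (r / 2 ^ (j + 1))) :=
          mul_le_mul_of_nonneg_left (h3.trans h5) (by positivity)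
        _ = _ := by ring
  refine ⟨c₂ / c₁ * Q, Q ^ 2, by positivity, one_le_pow₀ hQ1, fun i => ?_⟩
  have hr := (G i).resistanceDiam_pos
  have hM := (G i).totalMass_pos
  choose A hA hnet using fun k : ℕ =>
    (G i).exists_separated_net (δ := (1 / 4) ^ k * (G i).resistanceDiam) (by positivity)
  refine ⟨A, hnet, fun k => ?_⟩
  -- Separation `4⁻ᵏ r(G)` is twice the packing radius `r(G) / 2^{2k+1}`. Doubling `2k + 1` times
  -- returns to `r(G)` at cost `Q^{2k+1}`, whence `q = Q ^ 2`.
  have hδ : (1 / 4) ^ k * (G i).resistanceDiam = 2 * ((G i).resistanceDiam / 2 ^ (2 * k + 1)) := by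
    rw [pow_succ, pow_mul, one_div, inv_pow]
    norm_num
    field_simp
  have h3 := (G i).card_separated_mul_le h₁.le hmono (hvol i)
    (δ := (G i).resistanceDiam / 2 ^ (2 * k + 1)) (by positivity)
    (div_le_self hr.le (one_le_pow₀ one_le_two)) (A := A k) (by rw [← hδ]; exact hA k)
  have h4 := hdoub' _ hr.le (2 * k + 1)
  have h5 := hm i
  have h6 : ((A k).card : ℝ) * c₁ * (G i).totalMass
      ≤ (c₂ * Q ^ (2 * k + 1)) * (G i).totalMass := by
    calc ((A k).card : ℝ) * c₁ * (G i).totalMass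
        ≤ (A k).card * c₁ * (c₂ * (Q ^ (2 * k + 1) * v ((G i).resistanceDiam / 2 ^ (2 * k + 1)))) :=
          mul_le_mul_of_nonneg_left (h5.trans (mul_le_mul_of_nonneg_left h4 h₂.le))
            (by positivity)
      _ = (c₂ * Q ^ (2 * k + 1)) *
          ((A k).card * (c₁ * v ((G i).resistanceDiam / 2 ^ (2 * k + 1)))) := by ring
      _ ≤ _ := mul_le_mul_of_nonneg_left h3 (by positivity)
  have h7 := le_of_mul_le_mul_right h6 hM
  rw [← le_div_iff₀ h₁] at h7
  refine h7.trans_eq ?_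
  rw [pow_succ, pow_mul]
  ring

/-! ### Deterministic chaining -/

section Chaining

variable {V : Type*} [Fintype V] {G : WeightedGraph V} {C q : ℝ} {A : ℕ → Finset V}

theorem sum_range_add_one_mul_half_pow_le (K : ℕ) :
    ∑ j ∈ Finset.range K, ((1 + j) * (1 / 2) ^ j : ℝ) ≤ 4 := by
  have h : ∑ j ∈ Finset.range K, ((1 + j) * (1 / 2) ^ j : ℝ) = 4 - (2 * K + 4) * (1 / 2) ^ K := by
    induction K with
    | zero => norm_num
    | succ K ih =>
      rw [Finset.sum_range_succ, ih, pow_succ]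
      push_cast
      ring
  rw [h]
  have : (0 : ℝ) ≤ (2 * K + 4) * (1 / 2) ^ K := by positivity
  linarith

-- Join `x` and `y` to their level-`k` net points through successively finer ones. Each of the two
-- chains costs at most `W ∑ (1 + j) 2⁻ʲ ≤ 4 W`, and the link between the level-`k` points costs
-- `W`. The factor `3` admits that link, since its ends are within `(1 + 1 + 1) 4⁻ᵏ r(G)`.
open Classical in
theorem IsNetSequence.abs_sub_le_nine_mul (hA : G.IsNetSequence C q A) {g : V → ℝ} {W : ℝ} {k : ℕ}
    (hW : 0 ≤ W)
    (hg : ∀ j : ℕ, ∀ a ∈ A (k + j) ∪ A (k + j + 1), ∀ b ∈ A (k + j) ∪ A (k + j + 1),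
      G.resistance a b ≤ 3 * ((1 / 4) ^ (k + j) * G.resistanceDiam) →
      |g a - g b| ≤ W * ((1 + j) * (1 / 2) ^ j))
    {x y : V} (hxy : G.resistance x y ≤ (1 / 4) ^ k * G.resistanceDiam) :
    |g x - g y| ≤ 9 * W := by
  choose π hπ hπR using hA.exists_near
  have hr : 0 ≤ G.resistanceDiam :=
    (G.resistance_nonneg x y).trans (G.resistance_le_resistanceDiam x y)
  have htel : ∀ x K, |g (π k x) - g (π (k + K) x)|
      ≤ ∑ j ∈ Finset.range K, W * ((1 + j) * (1 / 2) ^ j : ℝ) := by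
    intro x K
    induction K with
    | zero => simp
    | succ K ih =>
      rw [Finset.sum_range_succ]
      refine (abs_sub_le _ (g (π (k + K) x)) _).trans (add_le_add ih ?_)
      refine hg K _ (Finset.mem_union_left _ (hπ _ _)) _ (Finset.mem_union_right _ (hπ _ _)) ?_
      have h1 := G.resistance_triangle (π (k + K) x) x (π (k + K + 1) x)
      rw [G.resistance_comm _ x] at h1
      have h2 := hπR (k + K) x
      have h3 := hπR (k + K + 1) x
      have h4 : (0 : ℝ) ≤ (1 / 4) ^ (k + K) * G.resistanceDiam := by positivity
      rw [pow_succ] at h3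
      change G.resistance _ (π (k + K + 1) x) ≤ _
      linarith
  -- By finiteness of `V` the chain reaches `x` after finitely many steps, so no continuity of `g`
  -- is needed.
  have hlim : ∀ x, ∀ᶠ K in atTop, π (k + K) x = x := by
    intro x
    have h1 : ∀ v, ∀ᶠ K in atTop, π (k + K) x = v → v = x := by
      intro v
      by_cases hv : v = x
      · exact Eventually.of_forall fun _ _ => hv
      have h2 : Tendsto (fun K : ℕ => (1 / 4 : ℝ) ^ (k + K) * G.resistanceDiam) atTop (𝓝 0) := by
        have h3 : Tendsto (fun K : ℕ => (1 / 4 : ℝ) ^ (k + K)) atTop (𝓝 0) := by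
          simp only [add_comm k]
          exact (tendsto_add_atTop_iff_nat k).2
            (tendsto_pow_atTop_nhds_zero_of_lt_one (by norm_num) (by norm_num))
        simpa using h3.mul_const G.resistanceDiam
      filter_upwards [h2.eventually_lt_const (G.resistance_pos (Ne.symm hv))] with K hK hKv
      have := hπR (k + K) x
      rw [hKv] at this
      linarith
    filter_upwards [eventually_all.2 h1] with K hK
    exact hK _ rfl
  have hclose : ∀ x, |g (π k x) - g x| ≤ 4 * W := by
    intro x
    obtain ⟨K, hK⟩ := (hlim x).exists
    have h1 := htel x K
    rw [hK, ← Finset.mul_sum] at h1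
    have := mul_le_mul_of_nonneg_left (sum_range_add_one_mul_half_pow_le K) hW
    linarith
  have h0 := hg 0 _ (Finset.mem_union_left _ (hπ k x)) _ (Finset.mem_union_left _ (hπ k y)) (by
    have h1 := G.resistance_triangle (π k x) x (π k y)
    have h2 := G.resistance_triangle x y (π k y)
    rw [G.resistance_comm _ x] at h1
    have h3 := hπR k x
    have h4 := hπR k y
    simp only [add_zero]
    linarith)
  simp only [add_zero, CharP.cast_eq_zero, pow_zero, mul_one] at h0
  have hx := hclose x
  have hy := hclose y
  rw [abs_le] at *
  constructor <;> linarith [h0.1, h0.2, hx.1, hx.2, hy.1, hy.2]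

end Chaining

/-! ### Local times and the union bound over net pairs -/

section LocalTime

variable {V : Type*} [Fintype V] (G : WeightedGraph V)

theorem localTime_nonneg (X : ℕ → V) (t : ℕ) (x : V) : 0 ≤ G.localTime X t x := by
  classical
  refine mul_nonneg (inv_nonneg.2 (G.vertexWeight_nonneg x)) (Finset.sum_nonneg fun i _ => ?_)
  split_ifs <;> norm_num

theorem sum_vertexWeight_mul_localTime [Nontrivial V] (X : ℕ → V) (t : ℕ) :
    ∑ x, G.vertexWeight x * G.localTime X t x = t := by
  classical
  have h1 : ∀ x, G.vertexWeight x * G.localTime X t x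
      = ∑ i ∈ Finset.range t, if X i = x then 1 else 0 := fun x => by
    rw [localTime, mul_inv_cancel_left₀ (G.vertexWeight_pos x).ne']
  rw [Finset.sum_congr rfl fun x _ => h1 x, Finset.sum_comm]
  simp

/-- The `μ`-weighted average of the local times is `t / m(G)`. -/
theorem exists_localTime_le [Nontrivial V] (X : ℕ → V) {t : ℕ} {s : ℝ}
    (ht : (t : ℝ) ≤ G.totalMass * s) : ∃ x, G.localTime X t x ≤ s := by
  by_contra! h
  have h1 : ∑ x, G.vertexWeight x * s < ∑ x, G.vertexWeight x * G.localTime X t x :=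
    Finset.sum_lt_sum_of_nonempty Finset.univ_nonempty fun x _ =>
      mul_lt_mul_of_pos_left (h x) (G.vertexWeight_pos x)
  rw [sum_vertexWeight_mul_localTime, ← Finset.sum_mul, ← totalMass_eq] at h1
  linarith

/-- The event that local time increments between points of `E k` at resistance at most
`3 · 4⁻ᵏ r(G)` violate the Gaussian-type bound with parameter `β k`, for some `k`. -/
def largeIncrement (E : ℕ → Finset V) (β u : ℕ → ℝ) (n : ℕ) : Set (ℕ → V) :=
  {X | ∃ k, ∃ a ∈ E k, ∃ b ∈ E k, G.resistance a b ≤ 3 * ((1 / 4) ^ k * G.resistanceDiam) ∧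
    ∃ t ≤ n, (1 / 2) ^ k * (3 * β k * G.localTime X t a + G.resistanceDiam * (u k / β k))
      < G.localTime X t a - G.localTime X t b}

theorem walkLaw_largeIncrement_le [Nontrivial V] [MeasurableSpace V] [DiscreteMeasurableSpace V]
    (E : ℕ → Finset V) {β u : ℕ → ℝ} (hβ : ∀ k, 0 < β k) (hu : ∀ k, 0 ≤ u k) (n : ℕ) (z : V) :
    G.walkLaw z (G.largeIncrement E β u n)
      ≤ ∑' k, ENNReal.ofReal ((E k).card ^ 2 * ((1 + 3 * β k) * Real.exp (-u k))) := by
  classical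
  have hr := G.resistanceDiam_pos
  set B : ℕ → V → V → Set (ℕ → V) := fun k a b =>
    {X | G.resistance a b ≤ 3 * ((1 / 4) ^ k * G.resistanceDiam) ∧
    ∃ t ≤ n, (1 / 2) ^ k * (3 * β k * G.localTime X t a + G.resistanceDiam * (u k / β k))
      < G.localTime X t a - G.localTime X t b} with hB
  have hBle : ∀ k a b, G.walkLaw z (B k a b)
      ≤ ENNReal.ofReal ((1 + 3 * β k) * Real.exp (-u k)) := by
    intro k a b
    have hβk := hβ k
    by_cases hab : a = b
    · subst hab
      have : B k a a = ∅ := by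
        ext X
        simp only [hB, Set.mem_ofPred_eq, Set.mem_empty_iff_false, iff_false, sub_self, not_and,
          not_exists, not_lt]
        intro _ t _
        have h1 := G.localTime_nonneg X t a
        have h2 := hu k
        positivity
      simp [this]
    by_cases hR : G.resistance a b ≤ 3 * ((1 / 4) ^ k * G.resistanceDiam)
    swap
    · have : B k a b = ∅ := Set.eq_empty_of_forall_notMem fun X hX => hR hX.1
      simp [this]
    have h2k : (0 : ℝ) < 2 ^ k := by positivity
    -- With this scaling, resistance at most `3 · 4⁻ᵏ r(G)` gives `θ R ≤ 3 β k 2⁻ᵏ`, while `u k / θ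
    -- = 2⁻ᵏ r(G) u k / β k`: these are the two terms of the threshold.
    set θ := β k * 2 ^ k / G.resistanceDiam with hθ
    have hθpos : 0 < θ := by positivity
    have hθR : θ * G.resistance a b ≤ 3 * β k * (1 / 2) ^ k := by
      calc θ * G.resistance a b ≤ θ * (3 * ((1 / 4) ^ k * G.resistanceDiam)) :=
            mul_le_mul_of_nonneg_left hR hθpos.le
        _ = 3 * β k * (2 ^ k * (1 / 4) ^ k) := by
            rw [hθ]
            field_simp
        _ = _ := by
            rw [← mul_pow]
            norm_num
    refine (measure_mono ?_).trans
      ((G.walkLaw_exists_localTime_sub_ge_le z hab hθpos.le (u k) n).trans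
        (ENNReal.ofReal_le_ofReal (mul_le_mul_of_nonneg_right ?_ (Real.exp_pos _).le)))
    · rintro X ⟨-, t, ht, hlt⟩
      refine ⟨t, ht, ?_⟩
      have h1 := mul_lt_mul_of_pos_left hlt hθpos
      have h2 : θ * ((1 / 2) ^ k * (G.resistanceDiam * (u k / β k))) = u k := by
        rw [hθ, one_div, inv_pow]
        field_simp
      have h3 : θ ^ 2 * G.resistance a b * G.localTime X t a
          ≤ θ * ((1 / 2) ^ k * (3 * β k * G.localTime X t a)) := by
        have := mul_le_mul_of_nonneg_left hθR
          (mul_nonneg hθpos.le (G.localTime_nonneg X t a))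
        nlinarith
      nlinarith
    · have : 3 * β k * (1 / 2) ^ k ≤ 3 * β k * 1 :=
        mul_le_mul_of_nonneg_left (pow_le_one₀ (by norm_num) (by norm_num)) (by positivity)
      linarith
  have hsub : G.largeIncrement E β u n ⊆ ⋃ k, ⋃ p ∈ E k ×ˢ E k, B k p.1 p.2 := by
    rintro X ⟨k, a, ha, b, hb, h⟩
    simp only [Set.mem_iUnion]
    exact ⟨k, (a, b), Finset.mk_mem_product ha hb, h⟩
  refine (measure_mono hsub).trans ((measure_iUnion_le _).trans (ENNReal.tsum_le_tsum fun k => ?_))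
  refine (measure_biUnion_finset_le _ _).trans ((Finset.sum_le_card_nsmul _ _ _
    fun p _ => hBle k p.1 p.2).trans_eq ?_)
  rw [nsmul_eq_mul, Finset.card_product, ← pow_two,
    ENNReal.ofReal_mul (p := ((E k).card : ℝ) ^ 2) (by positivity), Nat.cast_pow,
    ENNReal.ofReal_pow (Nat.cast_nonneg _), ENNReal.ofReal_natCast]

end LocalTime

/-! ### Maximum and modulus of continuity of the local times -/

section Modulus

variable {V : Type*} [Fintype V] {G : WeightedGraph V} {C q : ℝ} {A : ℕ → Finset V}

theorem abs_localTime_sub_le_of_notMem_largeIncrement {E : ℕ → Finset V} {β u : ℕ → ℝ}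
    {n t : ℕ} {X : ℕ → V} (hX : X ∉ G.largeIncrement E β u n) (hβ : ∀ k, 0 < β k)
    (ht : t ≤ n) {M : ℝ} (hM : ∀ x, G.localTime X t x ≤ M) {k : ℕ} {a b : V} (ha : a ∈ E k)
    (hb : b ∈ E k) (hab : G.resistance a b ≤ 3 * ((1 / 4) ^ k * G.resistanceDiam)) :
    |G.localTime X t a - G.localTime X t b|
      ≤ (1 / 2) ^ k * (3 * β k * M + G.resistanceDiam * (u k / β k)) := by
  have key : ∀ a ∈ E k, ∀ b ∈ E k, G.resistance a b ≤ 3 * ((1 / 4) ^ k * G.resistanceDiam) →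
      G.localTime X t a - G.localTime X t b
        ≤ (1 / 2) ^ k * (3 * β k * M + G.resistanceDiam * (u k / β k)) := by
    intro a ha b hb hab
    have h1 : G.localTime X t a - G.localTime X t b ≤ (1 / 2) ^ k *
        (3 * β k * G.localTime X t a + G.resistanceDiam * (u k / β k)) := by
      by_contra! h
      exact hX ⟨k, a, ha, b, hb, hab, t, ht, h⟩
    have h2 := mul_le_mul_of_nonneg_left (hM a) (mul_pos three_pos (hβ k)).le
    refine h1.trans (mul_le_mul_of_nonneg_left ?_ (by positivity))
    linarith
  rw [abs_sub_le_iff]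
  exact ⟨key a ha b hb hab, key b hb a ha (G.resistance_comm a b ▸ hab)⟩

variable [Nontrivial V]

-- Self-bounding of the maximum `M`: for `β = 1/54` the link bound has `3 β M = M / 18`, so chaining
-- from level `0` gives `M - L_t(x₀) ≤ 9 (M / 18 + 54 r(G) lam)`. The term `M / 2` is absorbed on
-- the left, and `x₀` is chosen with `L_t(x₀) ≤ T r(G)`.
open Classical in
theorem IsNetSequence.localTime_le (hA : G.IsNetSequence C q A) {T lam κ : ℝ} (hκ : 0 ≤ κ)
    (hlam : κ ≤ lam) {n t : ℕ} {X : ℕ → V}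
    (hX : X ∉ G.largeIncrement (fun k => A k ∪ A (k + 1)) (fun _ => 1 / 54)
      (fun k => lam + κ * k) n) (ht : t ≤ n)
    (htT : (t : ℝ) ≤ T * G.totalMass * G.resistanceDiam) (x : V) :
    G.localTime X t x ≤ (2 * T + 972 * lam) * G.resistanceDiam := by
  have hr := G.resistanceDiam_pos
  obtain ⟨x₁, hx₁⟩ := Finite.exists_max (G.localTime X t)
  obtain ⟨x₀, hx₀⟩ := G.exists_localTime_le X (t := t) (s := T * G.resistanceDiam)
    (htT.trans_eq (by ring))
  set M := G.localTime X t x₁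
  have hM0 : 0 ≤ M := G.localTime_nonneg X t x₁
  have hl0 : 0 ≤ lam := hκ.trans hlam
  have h1 := hA.abs_sub_le_nine_mul (g := G.localTime X t) (k := 0)
    (W := M / 18 + 54 * G.resistanceDiam * lam) (by positivity) (x := x₁) (y := x₀) (by
      intro j a ha b hb hab
      refine (abs_localTime_sub_le_of_notMem_largeIncrement hX (fun _ => by norm_num) ht hx₁
        ha hb hab).trans ?_
      have hj : (0 : ℝ) ≤ j := Nat.cast_nonneg j
      have h2 : κ * j ≤ lam * j := mul_le_mul_of_nonneg_right hlam hj
      have h3 : 3 * (1 / 54) * M + G.resistanceDiam * ((lam + κ * j) / (1 / 54))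
          ≤ (M / 18 + 54 * G.resistanceDiam * lam) * (1 + j) := by
        have h4 := mul_le_mul_of_nonneg_left h2 hr.le
        have h5 := mul_nonneg hM0 hj
        linarith
      have := mul_le_mul_of_nonneg_left h3 (by positivity : (0 : ℝ) ≤ (1 / 2) ^ j)
      simp only [zero_add]
      linarith)
    (by simpa using G.resistance_le_resistanceDiam x₁ x₀)
  have h2 := (le_abs_self _).trans h1
  have h3 := hx₁ x
  change M - _ ≤ _ at h2
  linarith

-- Chain from the level `k` with `4^{-(k+1)} < R̃(x, y) ≤ 4⁻ᵏ`. Then `2⁻ᵏ ≤ 2 √R̃` and `k ≤ ln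
-- R̃⁻¹`, which turns `2⁻ᵏ √(1 + k)` into the modulus.
open Classical in
theorem IsNetSequence.abs_localTime_sub_le (hA : G.IsNetSequence C q A) {lam κ S : ℝ}
    (hκ : 0 ≤ κ) (hlam : κ ≤ lam) (hlam0 : 0 < lam) {n t : ℕ} {X : ℕ → V}
    (hX : X ∉ G.largeIncrement (fun k => A k ∪ A (k + 1)) (fun k => √(lam + κ * k))
      (fun k => lam + κ * k) n) (ht : t ≤ n) (hS0 : 0 ≤ S)
    (hS : ∀ x, G.localTime X t x ≤ S * G.resistanceDiam) {x y : V} (hxy : x ≠ y) :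
    |G.localTime X t x - G.localTime X t y| ≤ 18 * (3 * S + 1) * √lam * G.resistanceDiam *
      √(G.scaledResistance x y * (1 + Real.log (G.scaledResistance x y)⁻¹)) := by
  have hr := G.resistanceDiam_pos
  set ρ := G.scaledResistance x y with hρ
  have hρ0 : 0 < ρ := mul_pos (inv_pos.2 hr) (G.resistance_pos hxy)
  have hRρ : G.resistance x y = ρ * G.resistanceDiam := by
    rw [hρ, scaledResistance]
    field_simp
  have hρ1 : ρ ≤ 1 := by
    have := G.resistance_le_resistanceDiam x y
    rw [hRρ] at this
    exact (mul_le_iff_le_one_left hr).1 this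
  obtain ⟨k, hk1, hk2⟩ := exists_nat_pow_near_of_lt_one hρ0 hρ1 (by norm_num : (0 : ℝ) < 1 / 4)
    (by norm_num)
  have hk0 : (0 : ℝ) ≤ k := Nat.cast_nonneg k
  have hlog : (k : ℝ) ≤ Real.log ρ⁻¹ := by
    rw [Real.log_inv]
    have h1 := Real.log_le_log hρ0 hk2
    rw [Real.log_pow, one_div, Real.log_inv] at h1
    have h2 : 1 ≤ Real.log 4 := by
      rw [show (4 : ℝ) = 2 ^ 2 by norm_num, Real.log_pow]
      have := Real.log_two_gt_d9
      push_cast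
      linarith
    nlinarith
  have hsqrt : (1 / 2) ^ k * √(lam * (1 + k)) ≤ 2 * √lam * √(ρ * (1 + Real.log ρ⁻¹)) := by
    rw [show (2 : ℝ) * √lam * √(ρ * (1 + Real.log ρ⁻¹)) = √(2 ^ 2) *
      √lam * √(ρ * (1 + Real.log ρ⁻¹)) by rw [Real.sqrt_sq two_pos.le],
      ← Real.sqrt_mul (by positivity), ← Real.sqrt_mul (by positivity)]
    have h1 : ((1 : ℝ) / 2) ^ k = √((1 / 4) ^ k) := by
      rw [show ((1 : ℝ) / 4) = (1 / 2) ^ 2 by norm_num, ← pow_mul, mul_comm 2, pow_mul,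
        Real.sqrt_sq (by positivity)]
    rw [h1, ← Real.sqrt_mul (by positivity)]
    refine Real.sqrt_le_sqrt ?_
    rw [pow_succ] at hk1
    have h2 : (1 / 4 : ℝ) ^ k ≤ 4 * ρ := by linarith
    calc (1 / 4 : ℝ) ^ k * (lam * (1 + k)) ≤ 4 * ρ * (lam * (1 + Real.log ρ⁻¹)) :=
          mul_le_mul h2 (mul_le_mul_of_nonneg_left (by linarith) hlam0.le) (by positivity)
            (by positivity)
      _ = _ := by ring
  have h1 := hA.abs_sub_le_nine_mul (g := G.localTime X t) (k := k)
    (W := (1 / 2) ^ k * √(lam * (1 + k)) * ((3 * S + 1) * G.resistanceDiam)) (by positivity)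
    (x := x) (y := y) (by
      intro j a ha b hb hab
      have hpos : ∀ i : ℕ, 0 < lam + κ * i := fun i => by positivity
      refine (abs_localTime_sub_le_of_notMem_largeIncrement hX
        (fun i => Real.sqrt_pos.2 (hpos i)) ht hS ha hb hab).trans ?_
      have hj : (0 : ℝ) ≤ j := Nat.cast_nonneg j
      -- Here `β = √u`, so `u / β = √u` and both terms of the threshold have the same order.
      rw [Real.div_sqrt]
      -- Since `κ ≤ lam`, the threshold is at most `lam (1 + k + j) ≤ lam (1 + k) (1 + j)²`; its
      -- root supplies the factor `1 + j` allowed in chaining.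
      have h2 : √(lam + κ * (k + j : ℕ)) ≤ √(lam * (1 + k)) * (1 + j) := by
        rw [Real.sqrt_le_iff]
        refine ⟨by positivity, ?_⟩
        rw [mul_pow, Real.sq_sqrt (by positivity)]
        have h3 : κ * (k + j) ≤ lam * (k + j) := mul_le_mul_of_nonneg_right hlam (by positivity)
        have h4 : 0 ≤ lam * (j + j ^ 2 + k * (2 * j + j ^ 2)) := by positivity
        push_cast
        linarith
      calc (1 / 2 : ℝ) ^ (k + j) * (3 * √(lam + κ * (k + j : ℕ)) * (S * G.resistanceDiam)
            + G.resistanceDiam * √(lam + κ * (k + j : ℕ)))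
          = (1 / 2) ^ (k + j) * ((3 * S + 1) * G.resistanceDiam) * √(lam + κ * (k + j : ℕ)) := by
            ring
        _ ≤ (1 / 2) ^ (k + j) * ((3 * S + 1) * G.resistanceDiam) *
            (√(lam * (1 + k)) * (1 + j)) := mul_le_mul_of_nonneg_left h2 (by positivity)
        _ = _ := by
            rw [pow_add]
            ring)
    (by rw [hRρ]; exact mul_le_mul_of_nonneg_right hk2 hr.le)
  refine h1.trans ?_
  have h2 := mul_le_mul_of_nonneg_right hsqrt
    (by positivity : 0 ≤ 9 * ((3 * S + 1) * G.resistanceDiam))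
  linarith

open Classical in
theorem IsNetSequence.maxLocalTimeRatio_le (hA : G.IsNetSequence C q A) {T lam κ : ℝ}
    (hT : 0 < T) (hκ : 0 ≤ κ) (hlam : κ ≤ lam) (hlam0 : 0 < lam) {n : ℕ}
    (hn : ∀ t : ℕ, (t : ℝ) ≤ T * G.totalMass * G.resistanceDiam → t ≤ n) {X : ℕ → V}
    (hX₁ : X ∉ G.largeIncrement (fun k => A k ∪ A (k + 1)) (fun _ => 1 / 54)
      (fun k => lam + κ * k) n)
    (hX₂ : X ∉ G.largeIncrement (fun k => A k ∪ A (k + 1)) (fun k => √(lam + κ * k))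
      (fun k => lam + κ * k) n) :
    G.maxLocalTimeRatio T X ≤ 18 * (3 * (2 * T + 972 * lam) + 1) * √lam := by
  have hr := G.resistanceDiam_pos
  have hm := G.totalMass_pos
  have hne : Nonempty {t : ℕ // (t : ℝ) ≤ T * G.totalMass * G.resistanceDiam} :=
    ⟨⟨0, by simp only [CharP.cast_eq_zero]; positivity⟩⟩
  refine ciSup_le fun x => ciSup_le fun y => ciSup_le fun t => ?_
  by_cases hxy : x = y
  · subst hxy
    simp only [sub_self, abs_zero, mul_zero, zero_div]
    positivity
  refine div_le_of_le_mul₀ (Real.sqrt_nonneg _) (by positivity) ?_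
  have h1 := hA.abs_localTime_sub_le hκ hlam hlam0 hX₂ (hn t t.2) (by positivity)
    (hA.localTime_le hκ hlam hX₁ (hn t t.2) t.2) hxy
  rw [inv_mul_le_iff₀ hr]
  exact h1.trans_eq (by ring)

-- As `β k ≤ e^{u k / 2}`, half of the exponent absorbs the prefactor `1 + 3 β k`. The other half is
-- `e^{-lam/2} (2 q²)⁻ᵏ`, which beats the `O(q^{2k})` pairs and leaves the summable `2⁻ᵏ`.
open Classical in
theorem IsNetSequence.walkLaw_largeIncrement_le [MeasurableSpace V] [DiscreteMeasurableSpace V]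
    (hA : G.IsNetSequence C q A) (hC : 0 < C) (hq : 1 ≤ q) {lam : ℝ} (hlam : 0 ≤ lam)
    {β : ℕ → ℝ} (hβ : ∀ k, 0 < β k)
    (hβu : ∀ k : ℕ, β k ≤ Real.exp ((lam + 2 * Real.log (2 * q ^ 2) * k) / 2)) (n : ℕ) (z : V) :
    G.walkLaw z (G.largeIncrement (fun k => A k ∪ A (k + 1)) β
      (fun k => lam + 2 * Real.log (2 * q ^ 2) * k) n)
      ≤ ENNReal.ofReal (32 * C ^ 2 * q ^ 2 * Real.exp (-lam / 2)) := by
  have hq0 : 0 < q := by linarith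
  have hlog : 0 ≤ Real.log (2 * q ^ 2) :=
    Real.log_nonneg (by nlinarith [one_le_pow₀ hq (n := 2)])
  have hu : ∀ k : ℕ, 0 ≤ lam + 2 * Real.log (2 * q ^ 2) * k := fun k => by positivity
  refine (G.walkLaw_largeIncrement_le _ hβ hu n z).trans ?_
  have hterm : ∀ k : ℕ, (((A k ∪ A (k + 1)).card : ℝ) ^ 2 *
      ((1 + 3 * β k) * Real.exp (-(lam + 2 * Real.log (2 * q ^ 2) * k))))
      ≤ 16 * C ^ 2 * q ^ 2 * Real.exp (-lam / 2) * (1 / 2) ^ k := by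
    intro k
    set w := lam + 2 * Real.log (2 * q ^ 2) * k with hw
    have hcard : ((A k ∪ A (k + 1)).card : ℝ) ≤ 2 * C * q ^ (k + 1) := by
      have h1 : ((A k ∪ A (k + 1)).card : ℝ) ≤ (A k).card + (A (k + 1)).card := by
        exact_mod_cast Finset.card_union_le _ _
      have h2 : q ^ k ≤ q ^ (k + 1) := pow_le_pow_right₀ hq k.le_succ
      have h3 := mul_le_mul_of_nonneg_left h2 hC.le
      linarith [hA.card_le k, hA.card_le (k + 1)]
    have h1 : 1 + 3 * β k ≤ 4 * Real.exp (w / 2) := by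
      have : 1 ≤ Real.exp (w / 2) := Real.one_le_exp (by linarith [hu k])
      linarith [hβu k]
    have h2 : Real.exp (w / 2) * Real.exp (-w) = Real.exp (-lam / 2) * ((2 * q ^ 2) ^ k)⁻¹ := by
      rw [← Real.exp_add, ← Real.exp_log (by positivity : 0 < (2 * q ^ 2) ^ k), ← Real.exp_neg,
        ← Real.exp_add, Real.log_pow, hw]
      congr 1
      ring
    have h3 : q ^ (k + 1) * q ^ (k + 1) * ((2 * q ^ 2) ^ k)⁻¹ = q ^ 2 * (1 / 2) ^ k := by
      rw [mul_pow, ← pow_mul, one_div, inv_pow]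
      field_simp
      ring
    calc ((A k ∪ A (k + 1)).card : ℝ) ^ 2 * ((1 + 3 * β k) * Real.exp (-w))
        ≤ (2 * C * q ^ (k + 1)) ^ 2 * (4 * Real.exp (w / 2) * Real.exp (-w)) := by
          have := hβ k
          gcongr
      _ = 16 * C ^ 2 * Real.exp (-lam / 2) *
          (q ^ (k + 1) * q ^ (k + 1) * ((2 * q ^ 2) ^ k)⁻¹) := by
          rw [mul_assoc 4, h2]
          ring
      _ = _ := by
          rw [h3]
          ring
  refine (ENNReal.tsum_le_tsum fun k => ENNReal.ofReal_le_ofReal (hterm k)).trans_eq ?_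
  rw [← ENNReal.ofReal_tsum_of_nonneg (fun k => by positivity)
    (summable_geometric_two.mul_left _), tsum_mul_left, tsum_geometric_two]
  congr 1
  ring

end Modulus

/-! ### Uniform tail bound and conclusion -/

theorem walkLaw_maxLocalTimeRatio_ge_le {V : Type*} [Fintype V] [Nontrivial V]
    [MeasurableSpace V] [DiscreteMeasurableSpace V] {G : WeightedGraph V} {C q : ℝ}
    {A : ℕ → Finset V} (hA : G.IsNetSequence C q A) (hC : 0 < C) (hq : 1 ≤ q) {T lam s : ℝ}
    (hT : 0 < T) (hlam : 2 * Real.log (2 * q ^ 2) ≤ lam)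
    (hs : 18 * (3 * (2 * T + 972 * lam) + 1) * √lam < s) (z : V) :
    G.walkLaw z {X | s ≤ G.maxLocalTimeRatio T X}
      ≤ ENNReal.ofReal (64 * C ^ 2 * q ^ 2 * Real.exp (-lam / 2)) := by
  classical
  have hlog : 0 < 2 * Real.log (2 * q ^ 2) :=
    mul_pos two_pos (Real.log_pos (by nlinarith [one_le_pow₀ hq (n := 2)]))
  have hlam0 := hlog.trans_le hlam
  have hu : ∀ k : ℕ, 0 < lam + 2 * Real.log (2 * q ^ 2) * k := fun k => by positivity
  obtain ⟨n, hn⟩ := exists_nat_ge (T * G.totalMass * G.resistanceDiam)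
  have hsub : {X | s ≤ G.maxLocalTimeRatio T X} ⊆
      G.largeIncrement (fun k => A k ∪ A (k + 1)) (fun _ => 1 / 54)
        (fun k => lam + 2 * Real.log (2 * q ^ 2) * k) n ∪
      G.largeIncrement (fun k => A k ∪ A (k + 1)) (fun k => √(lam + 2 * Real.log (2 * q ^ 2) * k))
        (fun k => lam + 2 * Real.log (2 * q ^ 2) * k) n := by
    intro X hX
    by_contra hX'
    rw [Set.mem_union, not_or] at hX'
    have := hA.maxLocalTimeRatio_le hT hlog.le hlam hlam0
      (fun t ht => by exact_mod_cast ht.trans hn) hX'.1 hX'.2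
    have h2 : s ≤ G.maxLocalTimeRatio T X := hX
    linarith
  refine (measure_mono hsub).trans ((measure_union_le _ _).trans ?_)
  refine (add_le_add
    (hA.walkLaw_largeIncrement_le hC hq hlam0.le (fun _ => by norm_num) (fun k => ?_) n z)
    (hA.walkLaw_largeIncrement_le hC hq hlam0.le (fun k => Real.sqrt_pos.2 (hu k))
      (fun k => ?_) n z)).trans_eq ?_
  · exact le_trans (by norm_num) (Real.one_le_exp (div_nonneg (hu k).le two_pos.le))
  · rw [Real.exp_half]
    have := Real.add_one_le_exp (lam + 2 * Real.log (2 * q ^ 2) * k)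
    exact Real.sqrt_le_sqrt (by linarith)
  · rw [← ENNReal.ofReal_add (by positivity) (by positivity)]
    congr 1
    ring

end WeightedGraph

end

theorem theorem1p4 {I : Type*} {V : I → Type*} [∀ i, Fintype (V i)] [∀ i, Nontrivial (V i)]
    [∀ i, MeasurableSpace (V i)] [∀ i, DiscreteMeasurableSpace (V i)]
    (G : ∀ i, WeightedGraph (V i)) (hG : WeightedGraph.UVD G) (T : ℝ) (hT : 0 < T) :
    Tendsto (fun lam : ℝ => ⨆ i : I, ⨆ z : V i,
        (G i).walkLaw z {X : ℕ → V i | lam ≤ (G i).maxLocalTimeRatio T X})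
      atTop (𝓝 0) := by
  obtain ⟨C, q, hC, hq, hnet⟩ := hG.exists_isNetSequence
  rw [ENNReal.tendsto_nhds_zero]
  intro ε hε
  have hlim : Tendsto (fun l : ℝ => ENNReal.ofReal (64 * C ^ 2 * q ^ 2 * Real.exp (-l / 2)))
      atTop (𝓝 0) := by
    rw [← ENNReal.ofReal_zero]
    refine ENNReal.tendsto_ofReal ?_
    have h1 : Tendsto (fun l : ℝ => Real.exp (-l / 2)) atTop (𝓝 0) := by
      simp only [neg_div]
      exact Real.tendsto_exp_neg_atTop_nhds_zero.comp (tendsto_id.atTop_div_const two_pos)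
    simpa using h1.const_mul (64 * C ^ 2 * q ^ 2)
  -- The parameter `l` is fixed from `C`, `q` and `ε` alone, so the level that `s` must exceed is
  -- the same for all graphs and starting points.
  obtain ⟨l, hl, hlq⟩ := ((hlim.eventually_le_const hε).and
    (eventually_ge_atTop (2 * Real.log (2 * q ^ 2)))).exists
  filter_upwards [eventually_gt_atTop (18 * (3 * (2 * T + 972 * l) + 1) * √l)] with s hs
  refine iSup_le fun i => iSup_le fun z => ?_
  obtain ⟨A, hA⟩ := hnet i
  exact (WeightedGraph.walkLaw_maxLocalTimeRatio_ge_le hA hC hq hT hlq hs z).trans hl
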